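/- Theorem (asymptotic normality of the square root of a Wishart matrix). Fix an integer $p\ge 1$. For each integer $m\ge p$ let $W=W^{(m)}\sim W_p(m,I_p)$ be a standard Wishart matrix, i.e. $W$ has the distribution of $\sum_{i=1}^m X_iX_i^\top$ with $X_1,\dots,X_m$ independent $\mathcal N_p(0,I_p)$ random vectors, and let $V=(v_{ij})=W^{1/2}$ be its symmetric positive semidefinite square root (almost surely positive definite). Then, as $m\to\infty$, $$(v_{11}-\sqrt m,\dots,v_{pp}-\sqrt m,\,v_{12},\dots,v_{p-1,p})^\top \xrightarrow{d} \mathcal N_{p(p+1)/2}\left(0,\begin{pmatrix}\tfrac12 I_p&0\\0&\tfrac14 I_{p(p-1)/2}\end{pmatrix}\right),$$ where the vector lists the diagonal entries of $V-\sqrt m\,I_p$ followed by its entries strictly above the diagonal, and convergence in distribution means weak convergence of the laws, and also convergence of the joint distribution functions at every continuity point of the limiting one. Equivalently, in matrix form, $$W^{1/2}-\sqrt m\,I_p\xrightarrow{d}\tfrac12 G,$$ where $G$ is a $p\times p$ Gaussian Wigner matrix: a random symmetric matrix whose diagonal entries are $\mathcal N(0,2)$, whose entries strictly above the diagonal are $\mathcal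 N(0,1)$, and all of these entries are mutually independent. -/

import Mathlib

open MeasureTheory ProbabilityTheory Filter
open scoped Topology MatrixOrder

/-- Matrices carry the product σ-algebra of their entries. -/
instance Matrix.instMeasurableSpaceEntries {m n α : Type*} [MeasurableSpace α] :
    MeasurableSpace (Matrix m n α) :=
  inferInstanceAs (MeasurableSpace (m → n → α))

instance Matrix.instBorelSpaceReal {m n : Type*} [Countable m] [Countable n] :
    BorelSpace (Matrix m n ℝ) :=
  inferInstanceAs (BorelSpace (m → n → ℝ))

/-- The Wishart distribution `W_p(m, S)`: the law of `∑ᵢ Xᵢ Xᵢᵀ` where `X₁, …, X_m` are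
independent with common law `N_p(0, S)` (`S` positive semidefinite). -/
noncomputable def wishartMeasure (p m : ℕ) (S : Matrix (Fin p) (Fin p) ℝ) :
    Measure (Matrix (Fin p) (Fin p) ℝ) :=
  (Measure.pi fun _ : Fin m => multivariateGaussian (0 : EuclideanSpace ℝ (Fin p)) S).map
    fun X => ∑ i, Matrix.vecMulVec (X i) (X i)

/-- Positions strictly above the diagonal of a `p × p` matrix. -/
abbrev StrictUpper (p : ℕ) : Type := {ij : Fin p × Fin p // ij.1 < ij.2}

/-- The vector of the diagonal entries of a matrix followed by its entries strictly above the
diagonal. -/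
noncomputable def upperVec {p : ℕ} (A : Matrix (Fin p) (Fin p) ℝ) :
    EuclideanSpace ℝ (Fin p ⊕ StrictUpper p) :=
  WithLp.toLp 2 (Sum.elim (fun i => A i i) (fun ij => A ij.1.1 ij.1.2))

/-- The block matrix `diag(½ I_p, ¼ I_{p(p-1)/2})`. -/
noncomputable def limitCov (p : ℕ) :
    Matrix (Fin p ⊕ StrictUpper p) (Fin p ⊕ StrictUpper p) ℝ :=
  Matrix.fromBlocks ((1 / 2 : ℝ) • 1) 0 0 ((1 / 4 : ℝ) • 1)

/-- The random matrix `G` is a Gaussian Wigner matrix: symmetric, with diagonal entries `N(0, 2)`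
and entries above the diagonal `N(0, 1)`, all of these being mutually independent. -/
structure IsGaussianWigner {p : ℕ} {Ω : Type*} [MeasurableSpace Ω]
    (G : Ω → Matrix (Fin p) (Fin p) ℝ) (P : Measure Ω) : Prop where
  symm : ∀ᵐ ω ∂P, (G ω).IsSymm
  diag : ∀ i, HasLaw (fun ω => G ω i i) (gaussianReal 0 2) P
  upper : ∀ i j, i < j → HasLaw (fun ω => G ω i j) (gaussianReal 0 1) P
  indep : iIndepFun (fun k ω => upperVec (G ω) k) P

/-- The joint distribution function `x ↦ P(X ≤ x)` (coordinatewise order) of a random vector. -/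
noncomputable def distFun {ι Ω : Type*} [MeasurableSpace Ω] (P : Measure Ω)
    (X : Ω → EuclideanSpace ℝ ι) (x : EuclideanSpace ℝ ι) : ℝ :=
  P.real {ω | ∀ i, X ω i ≤ x i}

/-!
Write `c = √m`, `Y = c⁻¹ W - c I` and `D = W^{1/2} - c I`. Since `W = (c I + D)²`, one has
`D - Y / 2 = -D² / (2 c)`. Moreover `c Y = D W^{1/2} + c D`, and positivity of `W^{1/2}` makes the
right-hand side at least as large as `c D` in the Frobenius norm, so `‖D - Y / 2‖ ≤ ‖Y‖² / (2 c)`.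
By the central limit theorem for `x xᵀ`, whose covariances are given by Isserlis' theorem, `Y / 2`
converges in distribution to the limit; the remainder then vanishes in probability and `D` has the
same limit by Slutsky's theorem.
-/

open scoped NNReal RealInnerProductSpace

section GaussianMoments

lemma iteratedDeriv_succ_id_mul_zero {g : ℝ → ℝ} {n : ℕ} (hg : ContDiffAt ℝ (n + 1) g 0) :
    iteratedDeriv (n + 1) (fun t => t * g t) 0 = (n + 1) * iteratedDeriv n g 0 := by
  rw [iteratedDeriv_fun_mul (by fun_prop) (by exact_mod_cast hg), Finset.sum_eq_single 1]
  · simp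
  · intro i _ hi
    simp [iteratedDeriv_fun_id_zero, hi]
  · simp

lemma integral_pow_gaussianReal_eq_iteratedDeriv (v : ℝ≥0) (n : ℕ) :
    ∫ x, x ^ n ∂gaussianReal 0 v = iteratedDeriv n (fun t => Real.exp (v * t ^ 2 / 2)) 0 := by
  have h := iteratedDeriv_mgf_zero (X := fun x : ℝ => x) (μ := gaussianReal 0 v) (by simp) n
  rw [mgf_fun_id_gaussianReal] at h
  simpa using h.symm

lemma integral_pow_add_two_gaussianReal (v : ℝ≥0) (n : ℕ) :
    ∫ x, x ^ (n + 2) ∂gaussianReal 0 v = (n + 1) * v * ∫ x, x ^ n ∂gaussianReal 0 v := by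
  have hderiv : deriv (fun t : ℝ => Real.exp (v * t ^ 2 / 2)) =
      fun t => t * (v * Real.exp (v * t ^ 2 / 2)) := by
    ext t
    have h : HasDerivAt (fun t : ℝ => v * t ^ 2 / 2) (v * t) t :=
      (((hasDerivAt_pow 2 t).const_mul (v : ℝ)).div_const 2).congr_deriv (by push_cast; ring)
    rw [h.exp.deriv]
    ring
  rw [integral_pow_gaussianReal_eq_iteratedDeriv, iteratedDeriv_succ', hderiv,
    iteratedDeriv_succ_id_mul_zero (by fun_prop), iteratedDeriv_const_mul_field,
    integral_pow_gaussianReal_eq_iteratedDeriv, mul_assoc]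

lemma integral_pow_four_gaussianReal (v : ℝ≥0) :
    ∫ x, x ^ 4 ∂gaussianReal 0 v = 3 * (v : ℝ) ^ 2 := by
  rw [integral_pow_add_two_gaussianReal, integral_pow_add_two_gaussianReal]
  norm_num
  ring

end GaussianMoments

section Isserlis

variable {E : Type*} [NormedAddCommGroup E] [NormedSpace ℝ E] [MeasurableSpace E] [BorelSpace E]
  {μ : Measure E} [IsGaussian μ]

lemma memLp_strongDual_mul_strongDual_of_isGaussian (L₁ L₂ : StrongDual ℝ E) :
    MemLp (fun x => L₁ x * L₂ x) 2 μ :=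
  have : ENNReal.HolderTriple 4 4 2 := ⟨by
    rw [← ENNReal.toReal_eq_toReal_iff' (by finiteness) (by finiteness),
      ENNReal.toReal_add (by finiteness) (by finiteness)]
    norm_num⟩
  (IsGaussian.memLp_dual μ L₂ 4 (by simp)).mul (IsGaussian.memLp_dual μ L₁ 4 (by simp))

variable [SecondCountableTopology E] [CompleteSpace E]

lemma integral_strongDual_pow_four_of_isGaussian (hμ : ∫ x, x ∂μ = 0) (L : StrongDual ℝ E) :
    ∫ x, L x ^ 4 ∂μ = 3 * covarianceBilinDual μ L L ^ 2 := by
  have hmap : μ.map L = gaussianReal 0 Var[L; μ].toNNReal := by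
    rw [IsGaussian.map_eq_gaussianReal, L.integral_comp_id_comm IsGaussian.integrable_id, hμ,
      map_zero]
  rw [← integral_map (φ := L) (f := fun x : ℝ => x ^ 4) (by fun_prop) (by fun_prop), hmap,
    integral_pow_four_gaussianReal, Real.coe_toNNReal _ (variance_nonneg _ _),
    covarianceBilinDual_self_eq_variance IsGaussian.memLp_two_id]

/-- **Isserlis' (Wick's) formula**. Polarization reduces it to the fourth moment of a single
functional. -/
theorem integral_strongDual_mul_four_of_isGaussian (hμ : ∫ x, x ∂μ = 0)
    (L₁ L₂ L₃ L₄ : StrongDual ℝ E) :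
    ∫ x, L₁ x * L₂ x * (L₃ x * L₄ x) ∂μ =
      covarianceBilinDual μ L₁ L₂ * covarianceBilinDual μ L₃ L₄ +
      covarianceBilinDual μ L₁ L₃ * covarianceBilinDual μ L₂ L₄ +
      covarianceBilinDual μ L₁ L₄ * covarianceBilinDual μ L₂ L₃ := by
  let signs : Finset ℝ := {1, -1}
  let L (ε : ℝ × ℝ × ℝ) : StrongDual ℝ E := L₁ + ε.1 • L₂ + ε.2.1 • L₃ + ε.2.2 • L₄
  have hsum (f : ℝ × ℝ × ℝ → ℝ) : ∑ ε ∈ signs ×ˢ signs ×ˢ signs, f ε =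
      f (1, 1, 1) + f (1, 1, -1) + (f (1, -1, 1) + f (1, -1, -1)) +
      (f (-1, 1, 1) + f (-1, 1, -1) + (f (-1, -1, 1) + f (-1, -1, -1))) := by
    simp only [signs, Finset.sum_product, Finset.sum_pair (show (1 : ℝ) ≠ -1 by norm_num)]
  have hpolarization (x : E) : L₁ x * L₂ x * (L₃ x * L₄ x) =
      192⁻¹ * ∑ ε ∈ signs ×ˢ signs ×ˢ signs, ε.1 * ε.2.1 * ε.2.2 * L ε x ^ 4 := by
    simp only [hsum, L, add_apply, smul_apply, smul_eq_mul]
    ring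
  have hint (ε) : Integrable (fun x => L ε x ^ 4) μ := by
    simpa [Even.pow_abs (show Even 4 by decide)] using
      (IsGaussian.memLp_dual μ (L ε) 4 (by simp)).integrable_norm_pow (by simp)
  simp_rw [hpolarization]
  rw [integral_const_mul, integral_finsetSum _ fun ε _ => (hint ε).const_mul _]
  simp_rw [integral_const_mul, integral_strongDual_pow_four_of_isGaussian hμ]
  have hcov (ε) : covarianceBilinDual μ (L ε) (L ε) =
      covarianceBilinDual μ L₁ L₁ + ε.1 ^ 2 * covarianceBilinDual μ L₂ L₂ +
      ε.2.1 ^ 2 * covarianceBilinDual μ L₃ L₃ + ε.2.2 ^ 2 * covarianceBilinDual μ L₄ L₄ +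
      2 * (ε.1 * covarianceBilinDual μ L₁ L₂ + ε.2.1 * covarianceBilinDual μ L₁ L₃ +
        ε.2.2 * covarianceBilinDual μ L₁ L₄ + ε.1 * ε.2.1 * covarianceBilinDual μ L₂ L₃ +
        ε.1 * ε.2.2 * covarianceBilinDual μ L₂ L₄ +
        ε.2.1 * ε.2.2 * covarianceBilinDual μ L₃ L₄) := by
    simp only [L, map_add, map_smul, add_apply, smul_apply, smul_eq_mul,
      covarianceBilinDual_comm L₂ L₁, covarianceBilinDual_comm L₃ L₁,
      covarianceBilinDual_comm L₄ L₁, covarianceBilinDual_comm L₃ L₂,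
      covarianceBilinDual_comm L₄ L₂, covarianceBilinDual_comm L₄ L₃]
    ring
  simp only [hsum, hcov]
  ring

end Isserlis

section GaussianVector

variable {ι : Type*} [Fintype ι] [DecidableEq ι] {S : Matrix ι ι ℝ}

lemma covarianceBilinDual_proj_multivariateGaussian {μ : EuclideanSpace ℝ ι} (hS : S.PosSemidef)
    (i j : ι) :
    covarianceBilinDual (multivariateGaussian μ S) (EuclideanSpace.proj i)
      (EuclideanSpace.proj j) = S i j := by
  rw [covarianceBilinDual_eq_covariance IsGaussian.memLp_two_id]
  exact covariance_eval_multivariateGaussian hS i j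

lemma integral_mul_multivariateGaussian_zero (hS : S.PosSemidef) (i j : ι) :
    ∫ x, x i * x j ∂multivariateGaussian 0 S = S i j := by
  have hmean (i : ι) : ∫ x, x i ∂multivariateGaussian 0 S = 0 := by
    simpa using
      (EuclideanSpace.proj i).integral_comp_id_comm (μ := multivariateGaussian 0 S)
        IsGaussian.integrable_id
  rw [← covariance_eval_multivariateGaussian (μ := 0) hS i j, covariance, hmean, hmean]
  simp only [sub_zero]

lemma memLp_mul_multivariateGaussian (μ : EuclideanSpace ℝ ι) (S : Matrix ι ι ℝ) (i j : ι) :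
    MemLp (fun x => x i * x j) 2 (multivariateGaussian μ S) :=
  memLp_strongDual_mul_strongDual_of_isGaussian (EuclideanSpace.proj i) (EuclideanSpace.proj j)

lemma covariance_mul_multivariateGaussian_zero (hS : S.PosSemidef) (i j k l : ι) :
    cov[fun x => x i * x j, fun x => x k * x l; multivariateGaussian 0 S] =
      S i k * S j l + S i l * S j k := by
  have hIsserlis := integral_strongDual_mul_four_of_isGaussian
    (μ := multivariateGaussian 0 S) integral_id_multivariateGaussian (EuclideanSpace.proj i)
    (EuclideanSpace.proj j) (EuclideanSpace.proj k) (EuclideanSpace.proj l)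
  simp only [covarianceBilinDual_proj_multivariateGaussian hS, PiLp.proj_apply] at hIsserlis
  rw [covariance_eq_sub (memLp_mul_multivariateGaussian 0 S i j)
    (memLp_mul_multivariateGaussian 0 S k l), integral_mul_multivariateGaussian_zero hS,
    integral_mul_multivariateGaussian_zero hS]
  simp only [Pi.mul_apply, hIsserlis]
  ring

end GaussianVector

section UpperTriangle

variable {p : ℕ}

/-- The position of the `k`-th coordinate of `upperVec`. -/
def upperIndex : Fin p ⊕ StrictUpper p → Fin p × Fin p :=
  Sum.elim (fun i => (i, i)) Subtype.val

lemma upperVec_apply (A : Matrix (Fin p) (Fin p) ℝ) (k : Fin p ⊕ StrictUpper p) :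
    upperVec A k = A (upperIndex k).1 (upperIndex k).2 := by
  rcases k with i | ij <;> rfl

lemma upperIndex_injective : Function.Injective (upperIndex (p := p)) := by
  rintro (i | ⟨⟨i, j⟩, hij⟩) (k | ⟨⟨k, l⟩, hkl⟩) h <;>
    simp_all only [upperIndex, Sum.elim_inl, Sum.elim_inr, Prod.mk.injEq] <;> grind

lemma limitCov_eq_diagonal (p : ℕ) :
    limitCov p = Matrix.diagonal (Sum.elim (fun _ => 1 / 2) (fun _ => 1 / 4)) := by
  ext (i | i) (j | j) <;> simp [limitCov, Matrix.diagonal_apply, Matrix.one_apply]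

lemma upperVec_sub (A B : Matrix (Fin p) (Fin p) ℝ) :
    upperVec (A - B) = upperVec A - upperVec B := by
  ext k
  simp [upperVec_apply]

lemma upperVec_smul (c : ℝ) (A : Matrix (Fin p) (Fin p) ℝ) :
    upperVec (c • A) = c • upperVec A := by
  ext k
  simp [upperVec_apply]

lemma upperVec_sum {ι : Type*} (s : Finset ι) (A : ι → Matrix (Fin p) (Fin p) ℝ) :
    upperVec (∑ k ∈ s, A k) = ∑ k ∈ s, upperVec (A k) := by
  ext k
  simp [upperVec_apply, Matrix.sum_apply]

lemma continuous_upperVec : Continuous (upperVec : Matrix (Fin p) (Fin p) ℝ → _) := by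
  refine (PiLp.continuous_toLp 2 _).comp (continuous_pi fun k => ?_)
  rcases k with i | ij <;> simp only [Sum.elim_inl, Sum.elim_inr] <;> fun_prop

/-- The symmetric matrix with prescribed entries on and above the diagonal, inverting `upperVec`
on symmetric matrices. -/
noncomputable def symmOfUpper (v : EuclideanSpace ℝ (Fin p ⊕ StrictUpper p)) :
    Matrix (Fin p) (Fin p) ℝ :=
  Matrix.of fun i j => if h : i < j then v (Sum.inr ⟨(i, j), h⟩)
    else if h : j < i then v (Sum.inr ⟨(j, i), h⟩) else v (Sum.inl i)

lemma continuous_symmOfUpper : Continuous (symmOfUpper (p := p)) := by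
  refine continuous_matrix fun i j => ?_
  simp only [symmOfUpper, Matrix.of_apply]
  split_ifs <;> fun_prop

lemma symmOfUpper_upperVec {A : Matrix (Fin p) (Fin p) ℝ} (hA : A.IsSymm) :
    symmOfUpper (upperVec A) = A := by
  ext i j
  simp only [symmOfUpper, Matrix.of_apply]
  split_ifs with hij hji
  · rfl
  · exact hA.apply i j
  · obtain rfl : i = j := le_antisymm (not_lt.1 hji) (not_lt.1 hij)
    rfl

lemma integral_upperVec_vecMulVec (k : Fin p ⊕ StrictUpper p) :
    ∫ x, upperVec (Matrix.vecMulVec x x) k ∂multivariateGaussian 0 1 =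
      upperVec (1 : Matrix (Fin p) (Fin p) ℝ) k := by
  simp only [upperVec_apply, Matrix.vecMulVec_apply]
  exact integral_mul_multivariateGaussian_zero Matrix.PosSemidef.one _ _

lemma covariance_upperVec_vecMulVec (k l : Fin p ⊕ StrictUpper p) :
    cov[fun x : EuclideanSpace ℝ (Fin p) => upperVec (Matrix.vecMulVec x x) k,
      fun x => upperVec (Matrix.vecMulVec x x) l; multivariateGaussian 0 1] =
        4 * limitCov p k l := by
  simp only [upperVec_apply, Matrix.vecMulVec_apply]
  rw [covariance_mul_multivariateGaussian_zero Matrix.PosSemidef.one, limitCov_eq_diagonal]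
  rcases k with i | ⟨⟨i, j⟩, hij⟩ <;> rcases l with a | ⟨⟨a, b⟩, hab⟩
  all_goals simp [upperIndex, Matrix.one_apply, Matrix.diagonal_apply]
  all_goals grind

end UpperTriangle

section CramerWold

variable {Ω' E : Type*} [MeasurableSpace Ω'] {P' : Measure Ω'} [NormedAddCommGroup E]
  [InnerProductSpace ℝ E] [MeasurableSpace E] [BorelSpace E]

lemma charFun_map_eq_charFun_map_inner [SecondCountableTopology E] {f : Ω' → E}
    (hf : AEMeasurable f P') (t : E) :
    charFun (P'.map f) t = charFun (P'.map fun ω => ⟪f ω, t⟫) 1 := by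
  rw [charFun_apply, charFun_apply_real, integral_map hf (by fun_prop),
    integral_map (by fun_prop) (by fun_prop)]
  simp

theorem tendstoInDistribution_of_forall_inner [FiniteDimensional ℝ E] [IsProbabilityMeasure P']
    {Ω : ℕ → Type*} [∀ n, MeasurableSpace (Ω n)] {P : ∀ n, Measure (Ω n)}
    [∀ n, IsProbabilityMeasure (P n)] {X : ∀ n, Ω n → E} {Z : Ω' → E}
    (hX : ∀ n, AEMeasurable (X n) (P n)) (hZ : AEMeasurable Z P')
    (h : ∀ t, TendstoInDistribution (fun n ω => ⟪X n ω, t⟫) atTop (fun ω => ⟪Z ω, t⟫) P P') :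
    TendstoInDistribution X atTop Z P P' where
  forall_aemeasurable := hX
  aemeasurable_limit := hZ
  tendsto := by
    refine ProbabilityMeasure.tendsto_iff_tendsto_charFun.2 fun t => ?_
    have hcharFun := ProbabilityMeasure.tendsto_iff_tendsto_charFun.1 (h t).tendsto 1
    simpa only [ProbabilityMeasure.coe_mk, charFun_map_eq_charFun_map_inner (hX _),
      charFun_map_eq_charFun_map_inner hZ] using hcharFun

end CramerWold

section CentralLimit

variable {κ Ω Ω' : Type*} [Fintype κ] [MeasurableSpace Ω] [MeasurableSpace Ω']
  {P : Measure Ω} {P' : Measure Ω'} {S : Matrix κ κ ℝ}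

open scoped Matrix

lemma variance_inner_eq_dotProduct_mulVec [IsFiniteMeasure P] {X : Ω → EuclideanSpace ℝ κ}
    (hX : MemLp X 2 P) (hcov : ∀ k l, cov[fun ω => X ω k, fun ω => X ω l; P] = S k l)
    (t : EuclideanSpace ℝ κ) :
    Var[fun ω => ⟪X ω, t⟫; P] = t ⬝ᵥ S *ᵥ t := by
  simp only [PiLp.inner_apply, RCLike.inner_apply, conj_trivial]
  rw [variance_fun_sum fun k => (hX.eval_piLp k).const_mul _]
  simp_rw [covariance_const_mul_left, covariance_const_mul_right, hcov, dotProduct, Matrix.mulVec,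
    dotProduct, Finset.mul_sum]
  exact Finset.sum_congr rfl fun k _ => Finset.sum_congr rfl fun l _ => by ring

lemma posSemidef_of_covariance_eq [IsFiniteMeasure P] {X : Ω → EuclideanSpace ℝ κ}
    (hX : MemLp X 2 P) (hcov : ∀ k l, cov[fun ω => X ω k, fun ω => X ω l; P] = S k l) :
    S.PosSemidef := by
  refine Matrix.PosSemidef.of_dotProduct_mulVec_nonneg ?_ fun t => ?_
  · ext k l
    simp [← hcov, covariance_comm]
  · have hvar := variance_inner_eq_dotProduct_mulVec hX hcov (WithLp.toLp 2 t)
    exact hvar ▸ variance_nonneg _ _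

variable [DecidableEq κ]

lemma hasLaw_inner_of_multivariateGaussian_zero (hS : S.PosSemidef) {Y : Ω → EuclideanSpace ℝ κ}
    (hY : HasLaw Y (multivariateGaussian 0 S) P) (t : EuclideanSpace ℝ κ) :
    HasLaw (fun ω => ⟪Y ω, t⟫) (gaussianReal 0 (t ⬝ᵥ S *ᵥ t).toNNReal) P := by
  have hinner : HasLaw (innerSL ℝ t) (gaussianReal 0 (t ⬝ᵥ S *ᵥ t).toNNReal)
      (multivariateGaussian 0 S) := by
    refine ⟨by fun_prop, ?_⟩
    rw [IsGaussian.map_eq_gaussianReal, (innerSL ℝ t).integral_comp_id_comm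
      IsGaussian.integrable_id, integral_id_multivariateGaussian, map_zero,
      ← variance_inner_eq_dotProduct_mulVec IsGaussian.memLp_two_id
        (covariance_eval_multivariateGaussian (μ := 0) hS) t]
    simp [real_inner_comm]
  exact (hinner.comp hY).congr (ae_of_all _ fun ω => real_inner_comm _ _)

theorem tendstoInDistribution_inv_sqrt_smul_sum_sub [IsProbabilityMeasure P]
    [IsProbabilityMeasure P'] {X : ℕ → Ω → EuclideanSpace ℝ κ} {Y : Ω' → EuclideanSpace ℝ κ}
    (hcov : ∀ k l, cov[fun ω => X 0 ω k, fun ω => X 0 ω l; P] = S k l)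
    (hY : HasLaw Y (multivariateGaussian 0 S) P') (hX : MemLp (X 0) 2 P) (hindep : iIndepFun X P)
    (hident : ∀ i, IdentDistrib (X i) (X 0) P P) :
    TendstoInDistribution
      (fun (n : ℕ) ω => (√(n : ℝ))⁻¹ • (∑ k ∈ Finset.range n, X k ω - (n : ℝ) • P[X 0])) atTop Y
      (fun _ => P) P' := by
  have hmeas (i) : AEMeasurable (X i) P := (hident i).aemeasurable_fst
  refine tendstoInDistribution_of_forall_inner (fun n => by fun_prop) hY.aemeasurable fun t => ?_
  have hinner : Measurable fun x : EuclideanSpace ℝ κ => ⟪x, t⟫ := by fun_prop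
  have hlaw := hasLaw_inner_of_multivariateGaussian_zero (posSemidef_of_covariance_eq hX hcov) hY t
  rw [← variance_inner_eq_dotProduct_mulVec hX hcov t] at hlaw
  have hCLT := tendstoInDistribution_inv_sqrt_mul_sum_sub (X := fun k ω => ⟪X k ω, t⟫) hlaw
    (hX.inner_const t) (hindep.comp _ fun _ => hinner) (fun i => (hident i).comp hinner)
  have hmean : ∫ ω, ⟪X 0 ω, t⟫ ∂P = ⟪P[X 0], t⟫ := by
    simp_rw [real_inner_comm t]
    exact integral_inner (hX.integrable one_le_two) t
  simpa [hmean, real_inner_smul_left, inner_sub_left, sum_inner] using hCLT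

theorem tendstoInDistribution_inv_sqrt_smul_sum_sub_infinitePi [IsProbabilityMeasure P]
    [IsProbabilityMeasure P'] {f : Ω → EuclideanSpace ℝ κ} {Y : Ω' → EuclideanSpace ℝ κ}
    (hcov : ∀ k l, cov[fun x => f x k, fun x => f x l; P] = S k l)
    (hY : HasLaw Y (multivariateGaussian 0 S) P') (hf : Measurable f) (hf₂ : MemLp f 2 P) :
    TendstoInDistribution
      (fun (n : ℕ) ω => (√(n : ℝ))⁻¹ • (∑ k ∈ Finset.range n, f (ω k) - (n : ℝ) • P[f])) atTop Y
      (fun _ => Measure.infinitePi fun _ : ℕ => P) P' := by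
  have heval (k : ℕ) := measurePreserving_eval_infinitePi (fun _ : ℕ => P) k
  have hident (k : ℕ) := ((heval k).hasLaw.identDistrib (heval 0).hasLaw).comp hf
  have hindep : iIndepFun (fun (k : ℕ) ω => f (ω k)) (Measure.infinitePi fun _ => P) :=
    iIndepFun_infinitePi fun _ => hf
  have hcov' (k l) :
      cov[fun ω => f (ω 0) k, fun ω => f (ω 0) l; Measure.infinitePi fun _ : ℕ => P] = S k l := by
    rw [← hcov]
    exact (heval 0).hasLaw.covariance_comp (f := fun x => f x k) (g := fun x => f x l)
      (by fun_prop) (by fun_prop)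
  rw [← (heval 0).hasLaw.integral_comp hf.aestronglyMeasurable]
  exact tendstoInDistribution_inv_sqrt_smul_sum_sub hcov' hY
    (hf₂.comp_measurePreserving (heval 0)) hindep hident

end CentralLimit

section MatrixSqrt

variable {n : Type*}

lemma isClosed_setOf_matrix_nonneg [Finite n] : IsClosed {A : Matrix n n ℝ | 0 ≤ A} := by
  have := Fintype.ofFinite n
  simp_rw [Matrix.nonneg_iff_posSemidef, Matrix.posSemidef_iff_dotProduct_mulVec,
    Matrix.IsHermitian, Set.ofPred_and, Set.ofPred_forall]
  exact (isClosed_eq (by fun_prop) (by fun_prop)).inter <| isClosed_iInter fun x =>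
    isClosed_le (by fun_prop) (by fun_prop)

variable [Fintype n]

/-- The square root is the inverse of the injective continuous map `A ↦ A * A` on the closed cone
of positive semidefinite matrices, and such inverses are measurable by Lusin-Souslin. -/
lemma measurable_cfcSqrt_matrix [DecidableEq n] :
    Measurable (CFC.sqrt : Matrix n n ℝ → Matrix n n ℝ) := by
  have : PolishSpace (Matrix n n ℝ) := inferInstanceAs (PolishSpace (n → n → ℝ))
  let square : {A : Matrix n n ℝ | 0 ≤ A} → Matrix n n ℝ := fun A => A.1 * A.1
  have hsquare (A) : CFC.sqrt (square A) = A.1 := CFC.sqrt_mul_self A.1 A.2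
  have hinj : Function.Injective square := fun A B h =>
    Subtype.ext (by rw [← hsquare A, ← hsquare B, h])
  have : PolishSpace {A : Matrix n n ℝ | 0 ≤ A} := isClosed_setOf_matrix_nonneg.polishSpace
  have hemb : MeasurableEmbedding square :=
    Continuous.measurableEmbedding (by fun_prop) hinj
  have hsqrt : CFC.sqrt = Function.extend square Subtype.val 0 := by
    ext1 A
    by_cases hA : 0 ≤ A
    · have hAsq : square ⟨CFC.sqrt A, CFC.sqrt_nonneg A⟩ = A := CFC.sqrt_mul_sqrt_self A hA
      rw [← hAsq, hinj.extend_apply, hsquare]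
    · rw [CFC.sqrt_of_not_nonneg hA, Function.extend_apply']
      · rfl
      · rintro ⟨B, rfl⟩
        exact hA (B.2.isSelfAdjoint.mul_self_nonneg)
  rw [hsqrt]
  exact hemb.measurable_extend measurable_subtype_coe measurable_zero

lemma isSymm_cfcSqrt [DecidableEq n] (A : Matrix n n ℝ) : (CFC.sqrt A).IsSymm :=
  (Matrix.nonneg_iff_posSemidef.1 (CFC.sqrt_nonneg A)).isHermitian

section Frobenius

open scoped Matrix.Norms.Frobenius

lemma frobenius_norm_sq (A : Matrix n n ℝ) : ‖A‖ ^ 2 = (A * A.conjTranspose).trace := by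
  rw [Matrix.frobenius_norm_def, ← Real.sqrt_eq_rpow, Real.sq_sqrt (by positivity)]
  simp [Matrix.trace, Matrix.mul_apply, sq]

/-- The cross term `tr (D V Dᴴ)` in the expansion of `‖D V + c D‖²` is nonnegative. -/
lemma mul_frobenius_norm_le_of_posSemidef {V : Matrix n n ℝ} (hV : V.PosSemidef)
    (D : Matrix n n ℝ) {c : ℝ} (hc : 0 ≤ c) : c * ‖D‖ ≤ ‖D * V + c • D‖ := by
  have hcross : 0 ≤ (D * V * D.conjTranspose).trace :=
    (hV.mul_mul_conjTranspose_same D).trace_nonneg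
  have hexpand : ‖D * V + c • D‖ ^ 2 =
      ‖D * V‖ ^ 2 + 2 * c * (D * V * D.conjTranspose).trace + (c * ‖D‖) ^ 2 := by
    rw [mul_pow]
    simp only [frobenius_norm_sq, Matrix.conjTranspose_add, Matrix.conjTranspose_smul,
      Matrix.conjTranspose_mul, hV.isHermitian.eq, add_mul, mul_add, Matrix.trace_add,
      Matrix.smul_mul, Matrix.mul_smul, Matrix.trace_smul, smul_eq_mul, star_trivial,
      Matrix.mul_assoc]
    ring
  refine abs_le_of_sq_le_sq' ?_ (norm_nonneg _) |>.2
  rw [hexpand]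
  have hquad := mul_nonneg (mul_nonneg zero_le_two hc) hcross
  nlinarith [sq_nonneg ‖D * V‖]

variable [DecidableEq n]

lemma sub_sub_half_smul_eq_neg_inv_smul_mul_self (V : Matrix n n ℝ) {c : ℝ} (hc : c ≠ 0) :
    (V - c • 1) - (1 / 2 : ℝ) • (c⁻¹ • (V * V) - c • 1) =
      -((2 * c)⁻¹ • ((V - c • 1) * (V - c • 1))) := by
  simp only [sub_mul, mul_sub, smul_mul_assoc, mul_smul_comm, one_mul, mul_one, smul_sub, smul_smul]
  ext i j
  simp only [Matrix.sub_apply, Matrix.smul_apply, Matrix.neg_apply, smul_eq_mul]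
  field_simp
  ring

lemma frobenius_norm_sub_smul_one_le {V : Matrix n n ℝ} (hV : V.PosSemidef) {c : ℝ}
    (hc : 0 < c) : ‖V - c • 1‖ ≤ ‖c⁻¹ • (V * V) - c • 1‖ := by
  have hsplit : (V - c • 1) * V + c • (V - c • 1) = c • (c⁻¹ • (V * V) - c • 1) := by
    rw [sub_mul, smul_sub, smul_sub, smul_inv_smul₀ hc.ne', smul_mul_assoc, one_mul]
    abel
  have h := mul_frobenius_norm_le_of_posSemidef hV (V - c • 1) hc.le
  rw [hsplit, norm_smul, Real.norm_of_nonneg hc.le] at h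
  exact le_of_mul_le_mul_left h hc

lemma frobenius_norm_sqrt_sub_sub_half_smul_le {A : Matrix n n ℝ} (hA : 0 ≤ A) {c : ℝ}
    (hc : 0 < c) :
    ‖(CFC.sqrt A - c • 1) - (1 / 2 : ℝ) • (c⁻¹ • A - c • 1)‖ ≤
      (2 * c)⁻¹ * ‖c⁻¹ • A - c • 1‖ ^ 2 := by
  have hV := Matrix.nonneg_iff_posSemidef.1 (CFC.sqrt_nonneg A)
  have hA' := CFC.sqrt_mul_sqrt_self A hA
  generalize CFC.sqrt A = V at *
  subst hA'
  rw [sub_sub_half_smul_eq_neg_inv_smul_mul_self _ hc.ne', norm_neg, norm_smul,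
    Real.norm_of_nonneg (by positivity)]
  gcongr
  calc ‖(V - c • 1) * (V - c • 1)‖ ≤ ‖V - c • 1‖ * ‖V - c • 1‖ := norm_mul_le _ _
    _ = ‖V - c • 1‖ ^ 2 := (sq _).symm
    _ ≤ ‖c⁻¹ • (V * V) - c • 1‖ ^ 2 := by gcongr; exact frobenius_norm_sub_smul_one_le hV hc

end Frobenius

end MatrixSqrt

section ConvergenceInDistribution

variable {ι Ω Ω' : Type*} {l : Filter ι} [MeasurableSpace Ω] [MeasurableSpace Ω'] {P : Measure Ω}
  {P' : Measure Ω'} [IsProbabilityMeasure P] [IsProbabilityMeasure P']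

lemma tendstoInMeasure_of_tendstoInDistribution_const {E : Type*} [PseudoEMetricSpace E]
    [MeasurableSpace E] [BorelSpace E] {X : ι → Ω → E} {c : E}
    (h : TendstoInDistribution X l (fun _ : Ω' => c) (fun _ => P) P') :
    TendstoInMeasure P X l fun _ => c := by
  intro ε hε
  have hclosed : IsClosed {x | ε ≤ edist x c} := isClosed_le (by fun_prop) (by fun_prop)
  have hc : P'.map (fun _ => c) {x | ε ≤ edist x c} = 0 := by
    simp [Measure.map_const, hclosed.measurableSet, hε.ne']
  have htendsto := ProbabilityMeasure.tendsto_measure_of_null_frontier_of_tendsto' h.tendsto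
    (measure_mono_null hclosed.frontier_subset hc)
  simp only [ProbabilityMeasure.coe_mk, hc] at htendsto
  exact htendsto.congr fun i =>
    Measure.map_apply_of_aemeasurable (h.forall_aemeasurable i) hclosed.measurableSet

lemma tendstoInMeasure_zero_of_norm_le_mul [l.IsCountablyGenerated] {E : Type*}
    [SeminormedAddCommGroup E] {a : ι → ℝ} (ha : Tendsto a l (𝓝 0)) {Y : ι → Ω → ℝ} {Z : Ω' → ℝ}
    (hY : TendstoInDistribution Y l Z (fun _ => P) P') {R : ι → Ω → E}
    (hR : ∀ᶠ i in l, ∀ ω, ‖R i ω‖ ≤ a i * Y i ω) : TendstoInMeasure P R l 0 := by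
  have ha' : TendstoInMeasure P (fun i _ => a i) l fun _ => (0 : ℝ) := fun ε hε => by
    refine tendsto_const_nhds.congr' ?_
    filter_upwards [EMetric.tendsto_nhds.1 ha ε hε] with i hi
    simp only [hi.not_ge, Set.ofPred_false, measure_empty]
  have hprod := hY.continuous_comp_prodMk_of_tendstoInMeasure_const
    (g := fun x : ℝ × ℝ => x.2 * x.1) (by fun_prop) ha' (fun i => by fun_prop)
  simp only [zero_mul] at hprod
  have hbound := tendstoInMeasure_of_tendstoInDistribution_const hprod
  rw [tendstoInMeasure_iff_norm] at hbound ⊢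
  intro ε hε
  refine tendsto_of_tendsto_of_tendsto_of_le_of_le' tendsto_const_nhds (hbound ε hε)
    (.of_forall fun _ => zero_le) ?_
  filter_upwards [hR] with i hi
  refine measure_mono fun ω (hω : ε ≤ _) => hω.trans ?_
  simpa using (hi ω).trans (le_abs_self _)

lemma tendstoInDistribution_comp_of_identDistrib {E κ : Type*} [TopologicalSpace E]
    [MeasurableSpace E] [OpensMeasurableSpace E] {Ω₁ : ι → Type*} {Ω₂ : κ → Type*}
    [∀ i, MeasurableSpace (Ω₁ i)] [∀ k, MeasurableSpace (Ω₂ k)] {P₁ : ∀ i, Measure (Ω₁ i)}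
    {P₂ : ∀ k, Measure (Ω₂ k)} [∀ i, IsProbabilityMeasure (P₁ i)]
    [∀ k, IsProbabilityMeasure (P₂ k)] {X : ∀ i, Ω₁ i → E} {Y : ∀ k, Ω₂ k → E} {Z : Ω' → E}
    (h : TendstoInDistribution X l Z P₁ P') {l' : Filter κ} {u : κ → ι} (hu : Tendsto u l' l)
    (hXY : ∀ k, IdentDistrib (Y k) (X (u k)) (P₂ k) (P₁ (u k))) :
    TendstoInDistribution Y l' Z P₂ P' where
  forall_aemeasurable k := (hXY k).aemeasurable_fst
  aemeasurable_limit := h.aemeasurable_limit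
  tendsto := (h.tendsto.comp hu).congr fun k => Subtype.ext (hXY k).map_eq.symm

end ConvergenceInDistribution

section DistributionFunction

variable {κ : Type*}

lemma isClosed_setOf_forall_apply_le (x : EuclideanSpace ℝ κ) :
    IsClosed {y : EuclideanSpace ℝ κ | ∀ k, y k ≤ x k} := by
  rw [Set.ofPred_forall]
  exact isClosed_iInter fun k => isClosed_le (by fun_prop) (by fun_prop)

variable [Finite κ]

lemma isOpen_setOf_forall_apply_lt (x : EuclideanSpace ℝ κ) :
    IsOpen {y : EuclideanSpace ℝ κ | ∀ k, y k < x k} := by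
  rw [Set.ofPred_forall]
  exact isOpen_iInter_of_finite fun k => isOpen_lt (by fun_prop) (by fun_prop)

variable {Ω' : Type*} [MeasurableSpace Ω'] {P' : Measure Ω'} {Z : Ω' → EuclideanSpace ℝ κ}

lemma distFun_eq_map_real (hZ : AEMeasurable Z P') (x : EuclideanSpace ℝ κ) :
    distFun P' Z x = (P'.map Z).real {y | ∀ k, y k ≤ x k} :=
  (map_measureReal_apply_of_aemeasurable hZ (isClosed_setOf_forall_apply_le x).measurableSet).symm

lemma distFun_le_map_real_setOf_forall_apply_lt_of_continuousAt [IsFiniteMeasure P']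
    (hZ : AEMeasurable Z P') {x : EuclideanSpace ℝ κ} (hx : ContinuousAt (distFun P' Z) x) :
    distFun P' Z x ≤ (P'.map Z).real {y | ∀ k, y k < x k} := by
  have := Fintype.ofFinite κ
  let shift (ε : ℝ) : EuclideanSpace ℝ κ := x - ε • WithLp.toLp 2 1
  have hshift : Tendsto shift (𝓝[>] 0) (𝓝 x) := by
    have hcont : Continuous shift := by fun_prop
    simpa [shift] using (hcont.tendsto 0).mono_left nhdsWithin_le_nhds
  refine le_of_tendsto (hx.tendsto.comp hshift) ?_
  filter_upwards [self_mem_nhdsWithin] with ε (hε : 0 < ε)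
  rw [Function.comp_apply, distFun_eq_map_real hZ]
  refine measureReal_mono fun y hy k => (hy k).trans_lt ?_
  simpa [shift] using hε

lemma measure_frontier_setOf_forall_apply_le_of_continuousAt [IsFiniteMeasure P']
    (hZ : AEMeasurable Z P') {x : EuclideanSpace ℝ κ} (hx : ContinuousAt (distFun P' Z) x) :
    P'.map Z (frontier {y | ∀ k, y k ≤ x k}) = 0 := by
  have hsub : {y : EuclideanSpace ℝ κ | ∀ k, y k < x k} ⊆ {y | ∀ k, y k ≤ x k} :=
    fun y hy k => (hy k).le
  have hopen := isOpen_setOf_forall_apply_lt x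
  have hfrontier : frontier {y : EuclideanSpace ℝ κ | ∀ k, y k ≤ x k} ⊆
      {y | ∀ k, y k ≤ x k} \ {y | ∀ k, y k < x k} := by
    rw [(isClosed_setOf_forall_apply_le x).frontier_eq]
    exact Set.sdiff_subset_sdiff_right (interior_maximal hsub hopen)
  refine measure_mono_null hfrontier ?_
  rw [← measureReal_eq_zero_iff, measureReal_sdiff hsub hopen.measurableSet,
    ← distFun_eq_map_real hZ]
  exact le_antisymm
    (sub_nonpos.2 (distFun_le_map_real_setOf_forall_apply_lt_of_continuousAt hZ hx))
    (sub_nonneg.2 (distFun_eq_map_real hZ x ▸ measureReal_mono hsub))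

theorem tendsto_distFun_of_tendstoInDistribution [IsProbabilityMeasure P'] {ι : Type*}
    {l : Filter ι} {Ω : ι → Type*} [∀ i, MeasurableSpace (Ω i)] {P : ∀ i, Measure (Ω i)}
    [∀ i, IsProbabilityMeasure (P i)] {X : ∀ i, Ω i → EuclideanSpace ℝ κ}
    (h : TendstoInDistribution X l Z P P') {x : EuclideanSpace ℝ κ}
    (hx : ContinuousAt (distFun P' Z) x) :
    Tendsto (fun i => distFun (P i) (X i) x) l (𝓝 (distFun P' Z x)) := by
  have := Measure.isProbabilityMeasure_map h.aemeasurable_limit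
  have htendsto := ProbabilityMeasure.tendsto_measure_of_null_frontier_of_tendsto' h.tendsto
    (measure_frontier_setOf_forall_apply_le_of_continuousAt h.aemeasurable_limit hx)
  simp only [distFun_eq_map_real h.aemeasurable_limit,
    distFun_eq_map_real (h.forall_aemeasurable _)]
  exact (ENNReal.tendsto_toReal (measure_ne_top _ _)).comp htendsto

end DistributionFunction

section Wigner

variable {κ Ω : Type*} [Fintype κ] [DecidableEq κ] [MeasurableSpace Ω] {P : Measure Ω}

lemma map_toLp_pi_gaussianReal_zero (v : κ → ℝ≥0) :
    (Measure.pi fun k => gaussianReal 0 (v k)).map (WithLp.toLp 2) =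
      multivariateGaussian 0 (Matrix.diagonal fun k => (v k : ℝ)) := by
  apply Measure.ext_of_charFun (E := EuclideanSpace ℝ κ)
  ext t
  rw [charFun_pi, charFun_multivariateGaussian
    (Matrix.PosSemidef.diagonal fun k => (v k).coe_nonneg)]
  simp only [charFun_gaussianReal, ← Complex.exp_sum, dotProduct, Matrix.mulVec_diagonal]
  congr 1
  simp [Finset.sum_div, Finset.sum_neg_distrib, mul_left_comm, sq]

lemma hasLaw_multivariateGaussian_diagonal_of_iIndepFun
    {X : Ω → EuclideanSpace ℝ κ} (hX : iIndepFun (fun k ω => X ω k) P) {v : κ → ℝ≥0}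
    (hlaw : ∀ k, HasLaw (fun ω => X ω k) (gaussianReal 0 (v k)) P) :
    HasLaw X (multivariateGaussian 0 (Matrix.diagonal fun k => (v k : ℝ))) P := by
  have htoLp : HasLaw (WithLp.toLp 2) (multivariateGaussian 0 (Matrix.diagonal fun k => (v k : ℝ)))
      (Measure.pi fun k => gaussianReal 0 (v k)) :=
    ⟨(PiLp.continuous_toLp 2 _).measurable.aemeasurable, map_toLp_pi_gaussianReal_zero v⟩
  exact htoLp.comp (iIndepFun.hasLaw_pi hlaw hX)

lemma IsGaussianWigner.hasLaw_upperVec_half_smul {p : ℕ}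
    {G : Ω → Matrix (Fin p) (Fin p) ℝ} (hG : IsGaussianWigner G P) :
    HasLaw (fun ω => upperVec ((1 / 2 : ℝ) • G ω)) (multivariateGaussian 0 (limitCov p)) P := by
  have hcov : limitCov p =
      Matrix.diagonal fun k => ((Sum.elim (fun _ => 1 / 2) (fun _ => 1 / 4) k : ℝ≥0) : ℝ) := by
    rw [limitCov_eq_diagonal]
    congr 1 with (i | ij) <;> simp
  rw [hcov]
  refine hasLaw_multivariateGaussian_diagonal_of_iIndepFun ?_ ?_
  · simp only [upperVec_smul]
    exact hG.indep.comp (fun _ x => (1 / 2 : ℝ) * x) fun _ => by fun_prop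
  · rintro (i | ⟨⟨i, j⟩, hij⟩)
    · convert gaussianReal_const_mul (hG.diag i) (1 / 2) using 2
      · rw [upperVec_smul]
        rfl
      · exact (mul_zero _).symm
      · refine NNReal.eq ?_
        norm_num
    · convert gaussianReal_const_mul (hG.upper i j hij) (1 / 2) using 2
      · rw [upperVec_smul]
        rfl
      · exact (mul_zero _).symm
      · refine NNReal.eq ?_
        norm_num

end Wigner

section Wishart

lemma infinitePi_map_fin {E : Type*} [MeasurableSpace E] (ν : Measure E) [IsProbabilityMeasure ν]
    (m : ℕ) :
    (Measure.infinitePi fun _ : ℕ => ν).map (fun ω (i : Fin m) => ω i) =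
      Measure.pi fun _ : Fin m => ν := by
  have hindep : iIndepFun (fun (i : Fin m) (ω : ℕ → E) => ω i) (Measure.infinitePi fun _ => ν) :=
    (iIndepFun_infinitePi (X := fun _ x => x) fun _ => measurable_id).precomp Fin.val_injective
  simpa only [Measure.infinitePi_map_eval] using
    hindep.map_fun_eq_pi_map fun i => (measurable_pi_apply _).aemeasurable

variable {p : ℕ}

/-- The Wishart matrices of all degrees of freedom, realized on a common probability space as the
sums `∑_{k < m} ω_k ω_kᵀ` along one sequence of vectors. -/
noncomputable def scatterMatrix (m : ℕ) (ω : ℕ → EuclideanSpace ℝ (Fin p)) :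
    Matrix (Fin p) (Fin p) ℝ :=
  ∑ k ∈ Finset.range m, Matrix.vecMulVec (ω k) (ω k)

lemma continuous_vecMulVec_self :
    Continuous fun x : EuclideanSpace ℝ (Fin p) => Matrix.vecMulVec x x := by
  refine continuous_matrix fun i j => ?_
  simp only [Matrix.vecMulVec_apply]
  fun_prop

lemma measurable_scatterMatrix (m : ℕ) :
    Measurable (scatterMatrix m : (ℕ → EuclideanSpace ℝ (Fin p)) → _) :=
  (continuous_finsetSum _ fun k _ =>
    continuous_vecMulVec_self.comp (continuous_apply k)).measurable

lemma scatterMatrix_nonneg (m : ℕ) (ω : ℕ → EuclideanSpace ℝ (Fin p)) :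
    0 ≤ scatterMatrix m ω := by
  refine Finset.sum_nonneg fun k _ => Matrix.PosSemidef.nonneg ?_
  simpa using Matrix.posSemidef_vecMulVec_self_star (WithLp.ofLp (ω k))

lemma hasLaw_scatterMatrix (m : ℕ) (S : Matrix (Fin p) (Fin p) ℝ) :
    HasLaw (scatterMatrix m) (wishartMeasure p m S)
      (Measure.infinitePi fun _ => multivariateGaussian 0 S) where
  aemeasurable := (measurable_scatterMatrix m).aemeasurable
  map_eq := by
    have hsum : Measurable fun x : Fin m → EuclideanSpace ℝ (Fin p) =>
        ∑ i, Matrix.vecMulVec (x i) (x i) :=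
      (continuous_finsetSum _ fun i _ =>
        continuous_vecMulVec_self.comp (continuous_apply i)).measurable
    rw [wishartMeasure, ← infinitePi_map_fin, Measure.map_map hsum (by fun_prop)]
    congr with ω : 1
    exact Finset.sum_range fun k => Matrix.vecMulVec (ω k) (ω k)

lemma memLp_upperVec_vecMulVec :
    MemLp (fun x : EuclideanSpace ℝ (Fin p) => upperVec (Matrix.vecMulVec x x)) 2
      (multivariateGaussian 0 1) := by
  rw [memLp_piLp_iff]
  intro k
  simp only [upperVec_apply, Matrix.vecMulVec_apply]
  exact memLp_mul_multivariateGaussian _ _ _ _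

lemma integral_upperVec_vecMulVec_eq_upperVec_one :
    ∫ x : EuclideanSpace ℝ (Fin p), upperVec (Matrix.vecMulVec x x) ∂multivariateGaussian 0 1 =
      upperVec 1 := by
  ext k
  rw [← integral_upperVec_vecMulVec]
  exact eval_integral_piLp
    (fun k => (memLp_upperVec_vecMulVec.eval_piLp k).integrable one_le_two) k

theorem tendstoInDistribution_half_smul_scatterMatrix
    {Ω' : Type*} [MeasurableSpace Ω'] {P' : Measure Ω'} [IsProbabilityMeasure P']
    {Z : Ω' → EuclideanSpace ℝ (Fin p ⊕ StrictUpper p)}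
    (hZ : HasLaw Z (multivariateGaussian 0 (limitCov p)) P') :
    TendstoInDistribution
      (fun (m : ℕ) ω => (1 / 2 : ℝ) •
        upperVec ((√(m : ℝ))⁻¹ • scatterMatrix m ω - √(m : ℝ) • 1)) atTop Z
      (fun _ => Measure.infinitePi fun _ => multivariateGaussian 0 1) P' := by
  let f (x : EuclideanSpace ℝ (Fin p)) := (1 / 2 : ℝ) • upperVec (Matrix.vecMulVec x x)
  have hf : Measurable f :=
    ((continuous_upperVec.comp continuous_vecMulVec_self).const_smul (1 / 2 : ℝ)).measurable
  have hcov (k l) :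
      cov[fun x => f x k, fun x => f x l; multivariateGaussian 0 1] = limitCov p k l := by
    simp only [f, PiLp.smul_apply, smul_eq_mul, covariance_const_mul_left,
      covariance_const_mul_right, covariance_upperVec_vecMulVec]
    ring
  have hmean : ∫ x, f x ∂multivariateGaussian 0 1 = (1 / 2 : ℝ) • upperVec 1 := by
    rw [integral_smul, integral_upperVec_vecMulVec_eq_upperVec_one]
  have hCLT := tendstoInDistribution_inv_sqrt_smul_sum_sub_infinitePi hcov hZ hf
    (memLp_upperVec_vecMulVec.const_smul (1 / 2 : ℝ))
  refine hCLT.congr (fun m => ae_of_all _ fun ω => ?_) .rfl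
  have hsqrt : (√(m : ℝ))⁻¹ * m = √(m : ℝ) := by rw [inv_mul_eq_div, Real.div_sqrt]
  rw [hmean, ← Finset.smul_sum, smul_comm (m : ℝ), ← smul_sub, smul_comm, smul_sub, smul_smul,
    hsqrt, ← upperVec_sum, ← upperVec_smul, ← upperVec_smul, ← upperVec_sub]
  rfl

end Wishart

section Slutsky

open scoped Matrix.Norms.Frobenius

variable {p : ℕ}

lemma norm_upperVec_le_frobenius_norm (A : Matrix (Fin p) (Fin p) ℝ) : ‖upperVec A‖ ≤ ‖A‖ := by
  rw [EuclideanSpace.norm_eq, Matrix.frobenius_norm_def, ← Real.sqrt_eq_rpow]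
  gcongr
  simp only [Real.rpow_two, upperVec_apply]
  rw [← Fintype.sum_prod_type', ← Finset.sum_image (f := fun ij => ‖A ij.1 ij.2‖ ^ 2)
    upperIndex_injective.injOn]
  exact Finset.sum_le_sum_of_subset_of_nonneg (Finset.subset_univ _) fun _ _ _ => by positivity

lemma continuous_frobenius_norm_symmOfUpper :
    Continuous fun v : EuclideanSpace ℝ (Fin p ⊕ StrictUpper p) => ‖symmOfUpper v‖ := by
  have hentry (i j : Fin p) := (continuous_symmOfUpper (p := p)).matrix_elem i j
  simp only [Matrix.frobenius_norm_def, ← Real.sqrt_eq_rpow, Real.rpow_two]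
  fun_prop

lemma norm_upperVec_sqrt_sub_sub_half_smul_le {A : Matrix (Fin p) (Fin p) ℝ} (hA : 0 ≤ A) {c : ℝ}
    (hc : 0 < c) :
    ‖upperVec (CFC.sqrt A - c • 1) - (1 / 2 : ℝ) • upperVec (c⁻¹ • A - c • 1)‖ ≤
      (2 * c)⁻¹ * ‖c⁻¹ • A - c • 1‖ ^ 2 := by
  rw [← upperVec_smul, ← upperVec_sub]
  exact (norm_upperVec_le_frobenius_norm _).trans (frobenius_norm_sqrt_sub_sub_half_smul_le hA hc)

lemma measurable_upperVec_sqrt_sub (c : ℝ) :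
    Measurable fun A : Matrix (Fin p) (Fin p) ℝ => upperVec (CFC.sqrt A - c • 1) := by
  have hcont : Continuous fun A : Matrix (Fin p) (Fin p) ℝ => upperVec (A - c • 1) :=
    continuous_upperVec.comp (by fun_prop)
  exact hcont.measurable.comp measurable_cfcSqrt_matrix

variable {Ω' : Type*} [MeasurableSpace Ω'] {P' : Measure Ω'} [IsProbabilityMeasure P']
  {Z : Ω' → EuclideanSpace ℝ (Fin p ⊕ StrictUpper p)}

theorem tendstoInDistribution_upperVec_sqrt_scatterMatrix
    (hZ : HasLaw Z (multivariateGaussian 0 (limitCov p)) P') :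
    TendstoInDistribution
      (fun (m : ℕ) ω => upperVec (CFC.sqrt (scatterMatrix m ω) - √(m : ℝ) • 1)) atTop Z
      (fun _ => Measure.infinitePi fun _ => multivariateGaussian 0 1) P' := by
  have hlinear := tendstoInDistribution_half_smul_scatterMatrix hZ
  have hnorm := hlinear.continuous_comp (g := fun v => ‖symmOfUpper ((2 : ℝ) • v)‖ ^ 2)
    ((continuous_frobenius_norm_symmOfUpper.comp (continuous_const_smul _)).pow 2)
  have hscale : Tendsto (fun m : ℕ => (2 * √(m : ℝ))⁻¹) atTop (𝓝 0) :=
    tendsto_inv_atTop_zero.comp ((Real.tendsto_sqrt_atTop.comp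
      tendsto_natCast_atTop_atTop).const_mul_atTop two_pos)
  refine tendstoInDistribution_of_tendstoInMeasure_sub _ _ hlinear
    (tendstoInMeasure_zero_of_norm_le_mul hscale hnorm ?_)
    fun m => ((measurable_upperVec_sqrt_sub _).comp (measurable_scatterMatrix m)).aemeasurable
  filter_upwards [eventually_gt_atTop 0] with m hm ω
  have hS := scatterMatrix_nonneg m ω
  have hsymm : ((√(m : ℝ))⁻¹ • scatterMatrix m ω - √(m : ℝ) • 1).IsSymm :=
    .sub (.smul (Matrix.nonneg_iff_posSemidef.1 hS).isHermitian _) (Matrix.isSymm_one.smul _)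
  have hbound := norm_upperVec_sqrt_sub_sub_half_smul_le hS (c := √(m : ℝ)) (by positivity)
  simpa [smul_smul, symmOfUpper_upperVec hsymm] using hbound

theorem tendstoInDistribution_upperVec_sqrt_wishart {ι : Type*} {l : Filter ι} {n : ι → ℕ}
    (hn : Tendsto n l atTop) {Ω : ι → Type*} [∀ i, MeasurableSpace (Ω i)]
    {P : ∀ i, Measure (Ω i)} [∀ i, IsProbabilityMeasure (P i)]
    {W : ∀ i, Ω i → Matrix (Fin p) (Fin p) ℝ}
    (hW : ∀ i, HasLaw (W i) (wishartMeasure p (n i) 1) (P i))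
    (hZ : HasLaw Z (multivariateGaussian 0 (limitCov p)) P') :
    TendstoInDistribution (fun i ω => upperVec (CFC.sqrt (W i ω) - √(n i : ℝ) • 1)) l Z P P' :=
  tendstoInDistribution_comp_of_identDistrib (tendstoInDistribution_upperVec_sqrt_scatterMatrix hZ)
    hn fun i => ((hW i).identDistrib (hasLaw_scatterMatrix (n i) 1)).comp
      (measurable_upperVec_sqrt_sub _)

end Slutsky

theorem mainTheorem2 (p : ℕ) (hp : 0 < p)
    -- for every `m ≥ p`, a random matrix `W m` with law `W_p(m, I_p)`
    {Ω : Set.Ici p → Type*} [∀ m, MeasurableSpace (Ω m)]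
    (P : ∀ m, Measure (Ω m)) [∀ m, IsProbabilityMeasure (P m)]
    (W : ∀ m, Ω m → Matrix (Fin p) (Fin p) ℝ)
    (hW : ∀ m, HasLaw (W m) (wishartMeasure p (m : ℕ) 1) (P m))
    -- a random vector `Z` with law `N(0, diag(½ I, ¼ I))`
    {Ω₁ : Type*} [MeasurableSpace Ω₁] (P₁ : Measure Ω₁) [IsProbabilityMeasure P₁]
    (Z : Ω₁ → EuclideanSpace ℝ (Fin p ⊕ StrictUpper p))
    (hZ : HasLaw Z (multivariateGaussian 0 (limitCov p)) P₁)
    -- a Gaussian Wigner matrix `G`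
    {Ω₂ : Type*} [MeasurableSpace Ω₂] (P₂ : Measure Ω₂) [IsProbabilityMeasure P₂]
    (G : Ω₂ → Matrix (Fin p) (Fin p) ℝ) (hG : IsGaussianWigner G P₂) :
    -- weak convergence of the laws of the vectors
    TendstoInDistribution
      (fun m ω => upperVec (CFC.sqrt (W m ω) - √((m : ℕ) : ℝ) • 1)) atTop Z P P₁ ∧
    -- convergence of the distribution functions of the vectors at all continuity points
    (∀ x, ContinuousAt (distFun P₁ Z) x →
      Tendsto
        (fun m => distFun (P m)
          (fun ω => upperVec (CFC.sqrt (W m ω) - √((m : ℕ) : ℝ) • 1)) x)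
        atTop (𝓝 (distFun P₁ Z x))) ∧
    -- weak convergence of the laws of the matrices
    TendstoInDistribution
      (fun m ω => CFC.sqrt (W m ω) - √((m : ℕ) : ℝ) • (1 : Matrix (Fin p) (Fin p) ℝ)) atTop
      (fun ω => (1 / 2 : ℝ) • G ω) P P₂ := by
  have hn : Tendsto (fun m : Set.Ici p => (m : ℕ)) atTop atTop :=
    tendsto_comp_val_Ici_atTop.2 tendsto_id
  have hvec := tendstoInDistribution_upperVec_sqrt_wishart hn hW hZ
  have hmat := (tendstoInDistribution_upperVec_sqrt_wishart hn hW
    hG.hasLaw_upperVec_half_smul).continuous_comp continuous_symmOfUpper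
  refine ⟨hvec, fun x hx => tendsto_distFun_of_tendstoInDistribution hvec hx, ?_⟩
  refine hmat.congr (fun m => ae_of_all _ fun ω => ?_) ?_
  · exact symmOfUpper_upperVec ((isSymm_cfcSqrt _).sub (Matrix.isSymm_one.smul _))
  · filter_upwards [hG.symm] with ω hω
    exact symmOfUpper_upperVec (hω.smul _)
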